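/- A well-labeled tree is a finite rooted plane tree $\tau$ with integer vertex labels $\ell$ such that the labels of any two adjacent vertices differ by at most $1$; $\mathrm{LT}_k$ is the set of well-labeled trees whose root has label $k\in\mathbb Z$, and $\rho_k$ is the probability measure on $\mathrm{LT}_k$ with $\rho_k((\tau,\ell))=\tfrac12\,12^{-|\tau|}$, where $|\tau|$ is the number of edges of $\tau$. Let $b=(b(i))_{i\in\mathbb Z}$ be a two-sided simple symmetric random walk with $b(0)=0$, that is, $(b(i))_{i\ge 0}$ and $(b(-i))_{i\ge 0}$ are two independent simple symmetric random walks started from $0$, and let $\mathrm{DS}(b)=\{i\in\mathbb Z: b(i+1)=b(i)-1\}$ be the set of its down-steps. Conditionally on $b$, let $T(i)$, $i\in\mathrm{DS}(b)$, be independent well-labeled trees, $T(i)$ having law $\rho_{b(i)}$; the pair $(b,T)$ is called a uniform infinite treed bridge. Let $H_1=\inf\{m\ge 0: b(m)=-1\}$ and $H'_1=\sup\{m\le 0: b(m)=-1\}$, write $\ell_i$ for the labels of $T(i)$, and set $$\Delta_0=\max_{i\in \mathrm{DS}(b)\cap[0,H_1)}\Bigl(-\min_{u\in V(T(i))}\ell_i(u)\Bigr),\qquad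 \Delta'_0=\max_{i\in \mathrm{DS}(b)\cap[H'_1,0)}\Bigl(-\min_{u\in V(T(i))}\ell_i(u)\Bigr),$$ with the convention $\max\emptyset=-\infty$. Then for every integer $m\ge 1$, $$\mathbb P(\Delta_0\ge m)=\frac1{m+1}\qquad\text{and}\qquad \mathbb P(\Delta'_0\ge m)=\frac1{m+3}.$$ -/

import Mathlib

open MeasureTheory ProbabilityTheory
open scoped ENNReal

/-- A finite rooted plane tree with an integer label at every vertex: a root vertex carrying
a label, together with the ordered list of the subtrees rooted at its children. -/
inductive LabeledTree where
  | node (label : ℤ) (children : List LabeledTree) : LabeledTree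

namespace LabeledTree

/-- The label of the root vertex. -/
def rootLabel : LabeledTree → ℤ
  | node l _ => l

/-- The labels of all the vertices (in depth-first order, with multiplicity). -/
def labels : LabeledTree → List ℤ
  | node l cs => l :: cs.flatMap labels

/-- The number of edges `|τ|`: every child contributes the edge above it and the edges of
its own subtree. -/
def numEdges : LabeledTree → ℕ
  | node _ cs => (cs.map fun c => numEdges c + 1).sum

/-- The labels of the two endpoints of every edge differ by at most one. -/
def WellLabeled : LabeledTree → Prop
  | node l cs => ∀ c ∈ cs, |c.rootLabel - l| ≤ 1 ∧ WellLabeled c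

theorem labels_node (l : ℤ) (cs : List LabeledTree) :
    labels (node l cs) = l :: cs.flatMap labels := by
  rw [labels]

theorem numEdges_node (l : ℤ) (cs : List LabeledTree) :
    numEdges (node l cs) = (cs.map fun c => numEdges c + 1).sum := by
  rw [numEdges]

theorem wellLabeled_node (l : ℤ) (cs : List LabeledTree) :
    WellLabeled (node l cs) ↔ ∀ c ∈ cs, |c.rootLabel - l| ≤ 1 ∧ WellLabeled c := by
  rw [WellLabeled]

theorem labels_ne_nil (t : LabeledTree) : t.labels ≠ [] := by
  cases t
  simp [labels_node]

/-- The minimal label among the vertices of the tree. -/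
def minLabel (t : LabeledTree) : ℤ :=
  t.labels.min t.labels_ne_nil

end LabeledTree

/-- `WLTree k`: the finite well-labeled plane trees whose root has label `k`. -/
def WLTree (k : ℤ) : Type :=
  {t : LabeledTree // t.WellLabeled ∧ t.rootLabel = k}

namespace WLTree

/-- The (countable) set `WLTree k` carries the discrete σ-algebra. -/
instance instMeasurableSpace (k : ℤ) : MeasurableSpace (WLTree k) := ⊤

instance instDiscreteMeasurableSpace (k : ℤ) : DiscreteMeasurableSpace (WLTree k) :=
  ⟨fun _ => trivial⟩

end WLTree

/-! ### The Boltzmann measure has total mass one -/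

namespace LabeledTree

/-- A labeled tree is a root label together with a list of labeled trees. -/
def equivProd : LabeledTree ≃ ℤ × List LabeledTree where
  toFun t := match t with
    | node l cs => (l, cs)
  invFun p := node p.1 p.2
  left_inv t := by cases t; rfl
  right_inv p := rfl

/-- Boltzmann weight `12^{-|τ|} / 2` on well-labeled trees with root label `k`, extended by `0`. -/
noncomputable def weight (k : ℤ) (t : LabeledTree) : ℝ≥0∞ :=
  open Classical in if t.WellLabeled ∧ t.rootLabel = k then (12⁻¹ : ℝ≥0∞) ^ t.numEdges / 2 else 0

/-- The same weight restricted to trees with less than `h` generations. -/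
noncomputable def weightTrunc : ℕ → ℤ → LabeledTree → ℝ≥0∞
  | 0, _, _ => 0
  | h + 1, k, node l cs =>
    if l = k then
      2⁻¹ * (cs.map fun c => 6⁻¹ *
        (weightTrunc h (k - 1) c + weightTrunc h k c + weightTrunc h (k + 1) c)).prod
    else 0

theorem weightTrunc_mono (h : ℕ) :
    ∀ k t, weightTrunc h k t ≤ weightTrunc (h + 1) k t := by
  induction h with
  | zero => intro k t; simp [weightTrunc]
  | succ h ih =>
    rintro k ⟨l, cs⟩
    rw [weightTrunc, weightTrunc]
    split_ifs
    · gcongr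
      induction cs with
      | nil => simp
      | cons c cs ihc =>
        simp only [List.map_cons, List.prod_cons]
        gcongr <;> apply ih
    · exact le_rfl

theorem sum_weight (k : ℤ) (t : LabeledTree) :
    weight (k - 1) t + weight k t + weight (k + 1) t
      = open Classical in if |t.rootLabel - k| ≤ 1 ∧ t.WellLabeled
        then (12⁻¹ : ℝ≥0∞) ^ t.numEdges / 2 else 0 := by
  unfold weight
  by_cases hw : t.WellLabeled
  · by_cases h1 : t.rootLabel = k - 1
    · have e1 : k - 1 ≠ k + 1 := by omega
      simp [hw, h1, e1]
    · by_cases h2 : t.rootLabel = k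
      · have e1 : k ≠ k - 1 := by omega
        simp [hw, h2, e1]
      · by_cases h3 : t.rootLabel = k + 1
        · have e1 : k + 1 ≠ k - 1 := by omega
          simp [hw, h3, e1]
        · have : ¬ |t.rootLabel - k| ≤ 1 := by rw [abs_le]; omega
          simp [hw, h1, h2, h3, this]
  · simp [hw]

theorem weight_node (k l : ℤ) (cs : List LabeledTree) :
    weight k (node l cs) = if l = k then
      2⁻¹ * (cs.map fun c => 6⁻¹ * (weight (k - 1) c + weight k c + weight (k + 1) c)).prod
    else 0 := by
  classical
  by_cases hl : l = k
  swap
  · simp [weight, rootLabel, hl]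
  subst hl
  simp only [sum_weight, if_true]
  unfold weight
  rw [wellLabeled_node, numEdges_node]
  have hr : (node l cs).rootLabel = l := rfl
  simp only [hr, and_true]
  clear hr
  have h12 : (6⁻¹ : ℝ≥0∞) * 2⁻¹ = 12⁻¹ := by
    rw [← ENNReal.mul_inv (by simp) (by simp)]; norm_num
  have key : (if ∀ c ∈ cs, |c.rootLabel - l| ≤ 1 ∧ c.WellLabeled then
      (12⁻¹ : ℝ≥0∞) ^ (cs.map fun c => numEdges c + 1).sum else 0)
      = (cs.map fun c => 6⁻¹ * if |c.rootLabel - l| ≤ 1 ∧ c.WellLabeled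
          then (12⁻¹ : ℝ≥0∞) ^ c.numEdges / 2 else 0).prod := by
    induction cs with
    | nil => simp
    | cons c cs ih =>
      simp only [List.map_cons, List.prod_cons, List.sum_cons, ← ih, List.forall_mem_cons]
      by_cases h1 : |c.rootLabel - l| ≤ 1 ∧ c.WellLabeled
      · by_cases h2 : ∀ c ∈ cs, |c.rootLabel - l| ≤ 1 ∧ c.WellLabeled
        · rw [if_pos ⟨h1, h2⟩, if_pos h1, if_pos h2, pow_add, pow_add, pow_one, ← h12,
            div_eq_mul_inv]
          ring
        · rw [if_neg (fun h => h2 h.2), if_neg h2, mul_zero]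
      · rw [if_neg (fun h => h1 h.1), if_neg h1, mul_zero, zero_mul]
  rw [← key]
  split_ifs
  · rw [div_eq_mul_inv, mul_comm]
  · simp

theorem weightTrunc_le (h : ℕ) : ∀ k t, weightTrunc h k t ≤ weight k t := by
  induction h with
  | zero => intro k t; simp [weightTrunc]
  | succ h ih =>
    rintro k ⟨l, cs⟩
    rw [weightTrunc, weight_node]
    split_ifs
    · gcongr
      induction cs with
      | nil => simp
      | cons c cs ihc =>
        simp only [List.map_cons, List.prod_cons]
        gcongr <;> apply ih
    · exact le_rfl

theorem weightTrunc_eventually : ∀ t : LabeledTree,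
    ∃ H, ∀ h, H ≤ h → ∀ k, weightTrunc h k t = weight k t
  | node l cs => by
    have hc : ∀ c ∈ cs, ∃ H, ∀ h, H ≤ h → ∀ k, weightTrunc h k c = weight k c :=
      fun c _ => weightTrunc_eventually c
    have hH : ∃ H, ∀ c ∈ cs, ∀ h, H ≤ h → ∀ k, weightTrunc h k c = weight k c := by
      clear * - hc
      induction cs with
      | nil => exact ⟨0, by simp⟩
      | cons c cs ih =>
        obtain ⟨H1, h1⟩ := hc c (by simp)
        obtain ⟨H2, h2⟩ := ih (fun c h => hc c (by simp [h]))
        refine ⟨max H1 H2, ?_⟩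
        intro d hd h hh k
        rcases List.mem_cons.1 hd with rfl | hd
        · exact h1 h (le_trans (le_max_left _ _) hh) k
        · exact h2 d hd h (le_trans (le_max_right _ _) hh) k
    obtain ⟨H, hH⟩ := hH
    refine ⟨H + 1, ?_⟩
    intro h hh k
    obtain ⟨h, rfl⟩ : ∃ h', h = h' + 1 := ⟨h - 1, by omega⟩
    rw [weightTrunc, weight_node]
    congr 3
    apply List.map_congr_left
    intro c hcm
    rw [hH c hcm h (by omega), hH c hcm h (by omega), hH c hcm h (by omega)]

theorem iSup_weightTrunc (k : ℤ) (t : LabeledTree) : ⨆ h, weightTrunc h k t = weight k t := by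
  apply le_antisymm
  · exact iSup_le fun h => weightTrunc_le h k t
  · obtain ⟨H, hH⟩ := weightTrunc_eventually t
    rw [← hH H le_rfl k]
    exact le_iSup (fun h => weightTrunc h k t) H

theorem tsum_list_prod {α : Type} (f : α → ℝ≥0∞) :
    ∑' l : List α, (l.map f).prod = (1 - ∑' a, f a)⁻¹ := by
  have hlen : ∀ n : ℕ, ∑' v : List.Vector α n, (v.1.map f).prod = (∑' a, f a) ^ n := by
    intro n
    induction n with
    | zero =>
      rw [tsum_eq_single List.Vector.nil (fun v hv => (hv (Subsingleton.elim _ _)).elim)]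
      simp [List.Vector.nil]
    | succ n ih =>
      let e : α × List.Vector α n ≃ List.Vector α (n + 1) :=
        { toFun := fun p => p.1 ::ᵥ p.2
          invFun := fun v => (v.head, v.tail)
          left_inv := fun p => by simp
          right_inv := fun v => by simp }
      rw [← e.tsum_eq, ENNReal.tsum_prod', pow_succ', ← ih, ← ENNReal.tsum_mul_right]
      apply tsum_congr
      intro a
      rw [← ENNReal.tsum_mul_left]
      apply tsum_congr
      rintro ⟨v, hv⟩
      simp [e, List.Vector.cons]
  rw [← ENNReal.tsum_geometric, ← (Equiv.sigmaFiberEquiv (List.length (α := α))).tsum_eq,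
    ENNReal.tsum_sigma']
  apply tsum_congr
  intro n
  rw [← hlen n]
  rfl

theorem tsum_weightTrunc (h : ℕ) : ∀ k, ∑' t, weightTrunc h k t = (h : ℝ≥0∞) / (h + 1) := by
  induction h with
  | zero => intro k; simp [weightTrunc]
  | succ h ih =>
    intro k
    rw [← equivProd.symm.tsum_eq, ENNReal.tsum_prod', tsum_eq_single k]
    swap
    · intro l hl
      simp [equivProd, weightTrunc, hl]
    simp only [equivProd, Equiv.coe_fn_symm_mk, weightTrunc, if_true]
    rw [ENNReal.tsum_mul_left, tsum_list_prod, ENNReal.tsum_mul_left, ENNReal.tsum_add,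
      ENNReal.tsum_add, ih, ih, ih]
    have e0 : ∀ n : ℕ, ((n : ℝ≥0∞) / (n + 1)) = ENNReal.ofReal ((n : ℝ) / (n + 1)) := by
      intro n
      rw [ENNReal.ofReal_div_of_pos (by positivity), ENNReal.ofReal_add (by positivity) (by simp)]
      simp
    have e := e0 h
    have e2 := e0 (h + 1)
    rw [Nat.cast_add_one (R := ℝ)] at e2
    have e6 : (6⁻¹ : ℝ≥0∞) = ENNReal.ofReal (6⁻¹ : ℝ) := by
      rw [ENNReal.ofReal_inv_of_pos (by norm_num)]; simp
    have e3 : (2⁻¹ : ℝ≥0∞) = ENNReal.ofReal (2⁻¹ : ℝ) := by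
      rw [ENNReal.ofReal_inv_of_pos (by norm_num)]; simp
    have hp : (0 : ℝ) ≤ (h : ℝ) / (h + 1) := by positivity
    have hlt : (h : ℝ) / (h + 1) < 1 := by
      rw [div_lt_one (by positivity)]; linarith
    rw [e2, e, e6, e3, ← ENNReal.ofReal_add hp hp, ← ENNReal.ofReal_add (by positivity) hp,
      ← ENNReal.ofReal_mul (by norm_num), ← ENNReal.ofReal_one,
      ← ENNReal.ofReal_sub _ (by positivity), ← ENNReal.ofReal_inv_of_pos (by linarith),
      ← ENNReal.ofReal_mul (by norm_num)]
    congr 1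
    have h1 : (h : ℝ) + 1 ≠ 0 := by positivity
    have h2 : (h : ℝ) + 1 + 1 ≠ 0 := by positivity
    have h3 : 1 - 6⁻¹ * ((h : ℝ) / (h + 1) + h / (h + 1) + h / (h + 1))
        = (h + 1 + 1) / (2 * (h + 1)) := by
      field_simp
      ring
    rw [h3]
    field_simp

theorem tsum_weight (k : ℤ) : ∑' t, weight k t = 1 := by
  have h1 : ∑' t, weight k t = ⨆ h, ∑' t, weightTrunc h k t := by
    simp only [← iSup_weightTrunc]
    let _ : MeasurableSpace LabeledTree := ⊤
    simp only [← lintegral_count]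
    exact lintegral_iSup (fun _ _ _ => trivial)
      (monotone_nat_of_le_succ fun h t => weightTrunc_mono h k t)
  have hmono : Monotone fun h => ∑' t, weightTrunc h k t :=
    monotone_nat_of_le_succ fun h => ENNReal.tsum_le_tsum fun t => weightTrunc_mono h k t
  rw [h1]
  refine tendsto_nhds_unique (tendsto_atTop_iSup hmono) ?_
  simp only [tsum_weightTrunc]
  have := (ENNReal.continuous_ofReal.tendsto _).comp (tendsto_natCast_div_add_atTop (1 : ℝ))
  rw [ENNReal.ofReal_one] at this
  refine this.congr fun h => ?_
  simp only [Function.comp]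
  rw [ENNReal.ofReal_div_of_pos (by positivity), ENNReal.ofReal_add (by positivity) (by simp)]
  simp

end LabeledTree

theorem WLTree.tsum_boltzmann (k : ℤ) :
    ∑' t : WLTree k, (12⁻¹ : ℝ≥0∞) ^ t.1.numEdges / 2 = 1 := by
  rw [← LabeledTree.tsum_weight k]
  have := tsum_subtype {t : LabeledTree | t.WellLabeled ∧ t.rootLabel = k}
    (fun t => (12⁻¹ : ℝ≥0∞) ^ t.numEdges / 2)
  refine Eq.trans this (tsum_congr fun t => ?_)
  simp [Set.indicator, LabeledTree.weight]

/-- The Boltzmann probability measure `ρ_k` on `WLTree k`: the tree `(τ, ℓ)` has probability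
`12^{-|τ|} / 2`. -/
noncomputable def boltzmann (k : ℤ) : PMF (WLTree k) :=
  ⟨fun t => (12⁻¹ : ℝ≥0∞) ^ t.1.numEdges / 2, by
    rw [← WLTree.tsum_boltzmann k]; exact ENNReal.summable.hasSum⟩

/-! ### Infinite treed bridges -/

/-- The set of down-steps of a two-sided sequence. -/
def DS (b : ℤ → ℤ) : Set ℤ :=
  {i | b (i + 1) = b i - 1}

/-- An infinite treed bridge: a two-sided sequence `b` with `b 0 = 0` and steps `±1`, and for each
down-step `i` of `b` a well-labeled tree `T i` whose root has label `b i`. -/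
structure TreedBridge where
  b : ℤ → ℤ
  b_zero : b 0 = 0
  b_step : ∀ i, |b (i + 1) - b i| = 1
  T : ∀ i : ℤ, i ∈ DS b → WLTree (b i)

namespace TreedBridge

/-- The σ-algebra on treed bridges generated by the values of the bridge and by the trees
(the set of trees being discrete). -/
instance instMeasurableSpace : MeasurableSpace TreedBridge :=
  MeasurableSpace.generateFrom
    ({S | ∃ i k : ℤ, S = {x : TreedBridge | x.b i = k}} ∪
      {S | ∃ (i : ℤ) (A : Set LabeledTree),
        S = {x : TreedBridge | ∃ hi : i ∈ DS x.b, (x.T i hi).1 ∈ A}})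

/-- `H_j = inf {m ≥ 0 : b m = -j}`, the first time `b` hits `-j` to the right of `0`
(`⊤` if it never does). -/
noncomputable def hitRight (b : ℤ → ℤ) (j : ℕ) : EReal :=
  ⨅ m ∈ {m : ℤ | 0 ≤ m ∧ b m = -(j : ℤ)}, ((m : ℝ) : EReal)

/-- `H'_j = sup {m ≤ 0 : b m = -j}`, the first time `b` hits `-j` to the left of `0`
(`⊥` if it never does). -/
noncomputable def hitLeft (b : ℤ → ℤ) (j : ℕ) : EReal :=
  ⨆ m ∈ {m : ℤ | m ≤ 0 ∧ b m = -(j : ℤ)}, ((m : ℝ) : EReal)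

/-- `Δ_j`: the maximum of `-(min ℓ_i + j)` over the trees grafted at the down-steps
`i ∈ [H_j, H_{j+1})`. The maximum over the empty set is `⊥`. -/
noncomputable def Delta (j : ℕ) (x : TreedBridge) : EReal :=
  ⨆ (i : ℤ) (hi : i ∈ DS x.b) (_ : hitRight x.b j ≤ ((i : ℝ) : EReal))
    (_ : ((i : ℝ) : EReal) < hitRight x.b (j + 1)),
    (((-((x.T i hi).1.minLabel + (j : ℤ)) : ℤ) : ℝ) : EReal)

/-- `Δ'_j`: the maximum of `-(min ℓ_i + j)` over the trees grafted at the down-steps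
`i ∈ [H'_{j+1}, H'_j)`. The maximum over the empty set is `⊥`. -/
noncomputable def Delta' (j : ℕ) (x : TreedBridge) : EReal :=
  ⨆ (i : ℤ) (hi : i ∈ DS x.b) (_ : hitLeft x.b (j + 1) ≤ ((i : ℝ) : EReal))
    (_ : ((i : ℝ) : EReal) < hitLeft x.b j),
    (((-((x.T i hi).1.minLabel + (j : ℤ)) : ℤ) : ℝ) : EReal)

/-! ### The uniform infinite treed bridge -/

/-- The walk started from `0` whose `k`-th step is `+1` if `s k` is true and `-1` otherwise. -/
def walk (s : ℕ → Bool) (n : ℕ) : ℤ :=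
  ∑ k ∈ Finset.range n, if s k then 1 else -1

/-- The two-sided sequence which is `walk s` to the right of `0` and `walk s'` to the left. -/
def twoSided (s s' : ℕ → Bool) (i : ℤ) : ℤ :=
  if 0 ≤ i then walk s i.toNat else walk s' (-i).toNat

theorem abs_walk_succ_sub (s : ℕ → Bool) (n : ℕ) : |walk s (n + 1) - walk s n| = 1 := by
  simp only [walk, Finset.sum_range_succ, add_sub_cancel_left]
  split_ifs <;> simp

theorem twoSided_zero (s s' : ℕ → Bool) : twoSided s s' 0 = 0 := by
  simp [twoSided, walk]

theorem twoSided_step (s s' : ℕ → Bool) (i : ℤ) :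
    |twoSided s s' (i + 1) - twoSided s s' i| = 1 := by
  unfold twoSided
  rcases lt_trichotomy i (-1) with h | h | h
  · rw [if_neg (by omega), if_neg (by omega), abs_sub_comm]
    have : (-i).toNat = (-(i + 1)).toNat + 1 := by omega
    rw [this]
    exact abs_walk_succ_sub _ _
  · subst h
    have := abs_walk_succ_sub s' 0
    simpa [walk] using this
  · rw [if_pos (by omega), if_pos (by omega)]
    have : (i + 1).toNat = i.toNat + 1 := by omega
    rw [this]
    exact abs_walk_succ_sub _ _

/-- The randomness: the steps of two walks, and a tree `θ (i, k) ∈ WLTree k` for every site `i` and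
every possible label `k` of that site. -/
abbrev Source : Type :=
  (ℕ → Bool) × (ℕ → Bool) × (∀ p : ℤ × ℤ, WLTree p.2)

/-- The steps are fair coin flips, the tree `θ (i, k)` has law `ρ_k`, and everything is
independent. -/
noncomputable def sourceMeasure : Measure Source :=
  (Measure.infinitePi fun _ : ℕ => (PMF.uniformOfFintype Bool).toMeasure).prod
    ((Measure.infinitePi fun _ : ℕ => (PMF.uniformOfFintype Bool).toMeasure).prod
      (Measure.infinitePi fun p : ℤ × ℤ => (boltzmann p.2).toMeasure))

/-- The treed bridge made of the two-sided walk `b` and of the trees `T i = θ (i, b i)` at its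
down-steps `i`. -/
def ofSource (ω : Source) : TreedBridge where
  b := twoSided ω.1 ω.2.1
  b_zero := twoSided_zero _ _
  b_step := twoSided_step _ _
  T := fun i _ => ω.2.2 (i, twoSided ω.1 ω.2.1 i)

theorem measurable_twoSided (i : ℤ) :
    Measurable fun ω : Source => twoSided ω.1 ω.2.1 i := by
  have hw : ∀ n, Measurable fun s : ℕ → Bool => walk s n := by
    intro n
    unfold walk
    refine Finset.measurable_sum _ fun k _ => ?_
    exact (measurable_of_countable fun c : Bool => if c then (1 : ℤ) else -1).comp
      (measurable_pi_apply k)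
  unfold twoSided
  split_ifs
  · exact (hw _).comp measurable_fst
  · exact (hw _).comp (measurable_fst.comp measurable_snd)

theorem measurable_ofSource : Measurable ofSource := by
  apply measurable_generateFrom
  rintro S (⟨i, k, rfl⟩ | ⟨i, A, rfl⟩)
  · exact measurable_twoSided i (measurableSet_singleton k)
  · have : ofSource ⁻¹' {x : TreedBridge | ∃ hi : i ∈ DS x.b, (x.T i hi).1 ∈ A}
        = {ω : Source | twoSided ω.1 ω.2.1 (i + 1) = twoSided ω.1 ω.2.1 i - 1} ∩
          ⋃ k : ℤ, ({ω : Source | twoSided ω.1 ω.2.1 i = k} ∩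
            (fun ω : Source => ω.2.2 (i, k)) ⁻¹' {t : WLTree k | t.1 ∈ A}) := by
      ext ω
      simp [ofSource, DS]
    rw [this]
    refine MeasurableSet.inter ?_ (MeasurableSet.iUnion fun k => MeasurableSet.inter ?_ ?_)
    · exact measurableSet_eq_fun (measurable_twoSided _) ((measurable_twoSided _).sub_const 1)
    · exact measurable_twoSided i (measurableSet_singleton k)
    · exact ((measurable_pi_apply (i, k)).comp (measurable_snd.comp measurable_snd))
        (MeasurableSet.of_discrete (s := {t : WLTree k | t.1 ∈ A}))

end TreedBridge

/-- The law of the uniform infinite treed bridge: the bridge is a two-sided simple symmetric random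
walk and, conditionally on it, the trees `T i` at its down-steps are independent with respective
laws `ρ_{b i}`. -/
noncomputable def uniformInfiniteTreedBridge : Measure TreedBridge :=
  TreedBridge.sourceMeasure.map TreedBridge.ofSource

/-! The complementary events `Δ_0 < m` and `Δ'_0 < m` say that every tree grafted before the walk
hits `-1` has all its labels above `-m`. Given the walk, this has probability a product of one
factor per grafted tree, so two generating functions decide everything. Trees: let `R n` be the mass
of trees whose root is `n` above a forbidden level. Decomposing at the root gives `R n = 1 / (2 (1 -
(R (n-1) + R n + R (n+1)) / 6))` for `n ≥ 1`, with `R 0 = 0`. A conserved quantity together with the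
limit `R n → 1` forces `R n = n (n+3) / ((n+1)(n+2))` (`toReal_massAbove`). Walks: on the right, a
down-step from height `x` costs `R (x+m)`. On the left the walk is read away from `0`, so that a
down-step of the bridge becomes an up-step `x → x+1`, carrying a tree of root label `x+1` and
costing `R (x+1+m)`. The expected cost up to the hitting time of `-1` solves a linear equation in
the starting height. A bounded nonnegative solution with boundary value `1` gives this expectation
(`tendsto_expWeight`), because the difference of two candidates is dominated by a convex sequence
argument. With `n` the starting height plus one, the solutions are `m/(m+n)` and `(m+2)/(m+2+n)`;
their values at `n = 1` are the complements of `1/(m+1)` and `1/(m+3)`. -/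

namespace LabeledTree

/-! ### Boltzmann mass of the trees with labels above a level -/

theorem lt_minLabel_iff (c : ℤ) (t : LabeledTree) : c < t.minLabel ↔ ∀ l ∈ t.labels, c < l := by
  unfold minLabel
  rw [← Int.add_one_le_iff, List.le_min_iff]
  simp only [Int.add_one_le_iff]

/-- The weight restricted to trees all of whose labels are larger than `c`. -/
noncomputable def weightAbove (c k : ℤ) (t : LabeledTree) : ℝ≥0∞ :=
  if c < t.minLabel then weight k t else 0

theorem weightAbove_le (c k : ℤ) (t : LabeledTree) : weightAbove c k t ≤ weight k t := by
  unfold weightAbove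
  split_ifs <;> simp

theorem lt_minLabel_node (c l : ℤ) (cs : List LabeledTree) :
    c < (node l cs).minLabel ↔ c < l ∧ ∀ t ∈ cs, c < t.minLabel := by
  simp only [lt_minLabel_iff, labels_node, List.mem_cons, forall_eq_or_imp, List.mem_flatMap]
  refine and_congr Iff.rfl ⟨fun h t ht l hl => h l ⟨t, ht, hl⟩, ?_⟩
  rintro h l ⟨t, ht, hl⟩
  exact h t ht l hl

/-- The constraint on the minimal label splits over the root and its subtrees, so the product form
of `weight_node` survives the restriction. -/
theorem weightAbove_node (c k l : ℤ) (cs : List LabeledTree) :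
    weightAbove c k (node l cs) = if l = k ∧ c < l then
      2⁻¹ * (cs.map fun t => 6⁻¹ *
        (weightAbove c (k - 1) t + weightAbove c k t + weightAbove c (k + 1) t)).prod
    else 0 := by
  have key : (if ∀ t ∈ cs, c < t.minLabel then
      (cs.map fun t => (6⁻¹ : ℝ≥0∞) * (weight (k - 1) t + weight k t + weight (k + 1) t)).prod
        else 0) = (cs.map fun t => 6⁻¹ *
        (weightAbove c (k - 1) t + weightAbove c k t + weightAbove c (k + 1) t)).prod := by
    induction cs with
    | nil => simp
    | cons t cs ih =>
      simp only [List.map_cons, List.prod_cons, ← ih, List.forall_mem_cons]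
      by_cases h1 : c < t.minLabel
      · by_cases h2 : ∀ t ∈ cs, c < t.minLabel
        · rw [if_pos ⟨h1, h2⟩, if_pos h2]
          simp [weightAbove, h1]
        · rw [if_neg (fun h => h2 h.2), if_neg h2, mul_zero]
      · rw [if_neg (fun h => h1 h.1)]
        simp [weightAbove, h1]
  rw [← key, weightAbove, weight_node]
  simp only [lt_minLabel_node]
  by_cases h1 : l = k <;> by_cases h2 : c < l <;>
    by_cases h3 : ∀ t ∈ cs, c < t.minLabel <;> simp [h1, h2, h3] <;> grind

/-- The probability that a tree with law `ρ_k` has all its labels larger than `c`. -/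
noncomputable def massAbove (c k : ℤ) : ℝ≥0∞ := ∑' t, weightAbove c k t

theorem massAbove_le_one (c k : ℤ) : massAbove c k ≤ 1 := by
  rw [← tsum_weight k]
  exact ENNReal.tsum_le_tsum fun t => weightAbove_le c k t

/-- Decomposition at the root: the ordered list of children contributes a geometric series. -/
theorem massAbove_eq (c k : ℤ) : massAbove c k = if c < k then
    2⁻¹ * (1 - 6⁻¹ * (massAbove c (k - 1) + massAbove c k + massAbove c (k + 1)))⁻¹ else 0 := by
  nth_rw 1 [massAbove]
  rw [← equivProd.symm.tsum_eq, ENNReal.tsum_prod', tsum_eq_single k]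
  swap
  · intro l hl
    simp [equivProd, weightAbove_node, hl]
  simp only [equivProd, Equiv.coe_fn_symm_mk, weightAbove_node, true_and]
  split_ifs
  · rw [ENNReal.tsum_mul_left, tsum_list_prod, ENNReal.tsum_mul_left, ENNReal.tsum_add,
      ENNReal.tsum_add]
    rfl
  · simp

/-- Labels drop by at most one per generation. This compares height truncation with label
truncation, and hence yields the limit of `massAbove` far above the level. -/
theorem sub_lt_minLabel_of_weightTrunc_ne_zero (h : ℕ) :
    ∀ k t, weightTrunc h k t ≠ 0 → k - h < t.minLabel := by
  induction h with
  | zero => intro k t ht; simp [weightTrunc] at ht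
  | succ h ih =>
    rintro k ⟨l, cs⟩ ht
    rw [weightTrunc] at ht
    split_ifs at ht with hl
    · subst hl
      rw [lt_minLabel_node]
      refine ⟨by push_cast; omega, fun t htc => ?_⟩
      have h1 := right_ne_zero_of_mul ht
      rw [Ne, List.prod_eq_zero_iff, List.mem_map] at h1
      have h2 : weightTrunc h (l - 1) t + weightTrunc h l t + weightTrunc h (l + 1) t ≠ 0 :=
        fun h0 => h1 ⟨t, htc, by rw [h0, mul_zero]⟩
      simp only [ne_eq, add_eq_zero, not_and_or] at h2
      push_cast
      rcases h2 with (h2 | h2) | h2 <;> have := ih _ _ h2 <;> omega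
    · exact absurd rfl ht

theorem div_le_massAbove (c k : ℤ) (h : ℕ) (hk : c + h ≤ k) :
    (h : ℝ≥0∞) / (h + 1) ≤ massAbove c k := by
  rw [← tsum_weightTrunc h k]
  refine ENNReal.tsum_le_tsum fun t => ?_
  by_cases ht : weightTrunc h k t = 0
  · simp [ht]
  · have := sub_lt_minLabel_of_weightTrunc_ne_zero h k t ht
    rw [weightAbove, if_pos (by omega)]
    exact weightTrunc_le h k t

/-- The solution of the recursion for the generating functions of well-labeled trees with
positive labels is determined by its limit. -/
theorem eq_of_treeRecursion (r : ℕ → ℝ) (h0 : r 0 = 0)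
    (hr : ∀ n, r (n + 1) * (2 * (1 - (r n + r (n + 1) + r (n + 2)) / 6)) = 1)
    (hlim : Filter.Tendsto r Filter.atTop (nhds 1)) (n : ℕ) :
    r n = n * (n + 3) / ((n + 1) * (n + 2)) := by
  -- A discrete first integral: two consecutive values differ by `2 (r (n+2) - r n)` times the
  -- defect of the recursion at `n`. Its value at `n = 0` is `-2 r 1` because `r 0 = 0`.
  have hI : ∀ n, 4 * r n * r (n + 1) * (1 - (r n + r (n + 1)) / 6) - 2 * r n - 2 * r (n + 1)
      = - 2 * r 1 := by
    intro n
    induction n with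
    | zero => rw [h0]; ring
    | succ n ih =>
      rw [← ih]
      linear_combination (2 * (r (n + 2) - r n)) * hr n
  -- The first integral tends to `-4/3`, which fixes the one free initial value of the second-order
  -- recursion.
  have h1 : r 1 = 2 / 3 := by
    have hlim' := (Filter.tendsto_add_atTop_iff_nat 1).2 hlim
    have ht : Filter.Tendsto (fun n => 4 * r n * r (n + 1) * (1 - (r n + r (n + 1)) / 6)
        - 2 * r n - 2 * r (n + 1)) Filter.atTop
        (nhds (4 * 1 * 1 * (1 - (1 + 1) / 6) - 2 * 1 - 2 * 1)) :=
      (((((hlim.const_mul 4).mul hlim').mul (((hlim.add hlim').div_const 6).const_sub 1)).sub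
        (hlim.const_mul 2)).sub (hlim'.const_mul 2))
    simp only [hI] at ht
    have := tendsto_nhds_unique ht tendsto_const_nhds
    linarith
  have hboth : ∀ n : ℕ, r n = n * (n + 3) / ((n + 1) * (n + 2)) ∧
      r (n + 1) = (n + 1) * (n + 4) / ((n + 2) * (n + 3)) := by
    intro n
    induction n with
    | zero => rw [h0, h1]; norm_num
    | succ n ih =>
      obtain ⟨ih1, ih2⟩ := ih
      push_cast
      refine ⟨by rw [ih2]; ring_nf, ?_⟩
      have h := hr n
      have hn : (0 : ℝ) ≤ n := n.cast_nonneg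
      rw [ih1, ih2] at h
      -- The recursion solved for its last term: `r (n+2) = 6 - r n - r (n+1) - 3 / r (n+1)`.
      have e : r (n + 1 + 1) = 6 - n * (n + 3) / ((n + 1) * (n + 2))
          - (n + 1) * (n + 4) / ((n + 2) * (n + 3)) - 3 * ((n + 2) * (n + 3) / ((n + 1) * (n + 4)))
          := by
        have hne : ((n : ℝ) + 1) * (n + 4) / ((n + 2) * (n + 3)) ≠ 0 := by positivity
        have hinv : ((n : ℝ) + 2) * (n + 3) / ((n + 1) * (n + 4))
            = (((n : ℝ) + 1) * (n + 4) / ((n + 2) * (n + 3)))⁻¹ := by rw [inv_div]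
        rw [hinv]
        have := eq_inv_of_mul_eq_one_right h
        change r (n + 2) = _
        linarith
      rw [e]
      field_simp
      ring
  exact (hboth n).1

theorem toReal_massAbove (c : ℤ) (n : ℕ) :
    (massAbove c (c + n)).toReal = n * (n + 3) / ((n + 1) * (n + 2)) := by
  have hfin : ∀ k, massAbove c k ≠ ∞ := fun k =>
    ne_top_of_le_ne_top ENNReal.one_ne_top (massAbove_le_one c k)
  have hle : ∀ k, (massAbove c k).toReal ≤ 1 := fun k => by
    simpa using ENNReal.toReal_mono ENNReal.one_ne_top (massAbove_le_one c k)
  refine eq_of_treeRecursion (fun n => (massAbove c (c + n)).toReal) ?_ ?_ ?_ n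
  · simp [massAbove_eq c c]
  · intro n
    have h := massAbove_eq c (c + (n + 1 : ℕ))
    rw [if_pos (by push_cast; omega)] at h
    have e1 : c + ((n + 1 : ℕ) : ℤ) - 1 = c + n := by push_cast; ring
    have e2 : c + ((n + 1 : ℕ) : ℤ) + 1 = c + (n + 2 : ℕ) := by push_cast; ring
    rw [e1, e2] at h
    -- Ensures that the truncated subtraction in `ℝ≥0∞` is a genuine one before passing to the
    -- reals.
    have hS : (6⁻¹ : ℝ≥0∞) * (massAbove c (c + n) + massAbove c (c + (n + 1 : ℕ))
        + massAbove c (c + (n + 2 : ℕ))) ≤ 1 := by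
      calc _ ≤ (6⁻¹ : ℝ≥0∞) * (1 + 1 + 1) := by gcongr <;> apply massAbove_le_one
        _ ≤ 6⁻¹ * 6 := by gcongr; norm_num
        _ = 1 := ENNReal.inv_mul_cancel (by simp) (by simp)
    have h' := congrArg ENNReal.toReal h
    rw [ENNReal.toReal_mul, ENNReal.toReal_inv, ENNReal.toReal_inv,
      ENNReal.toReal_sub_of_le hS (by simp), ENNReal.toReal_mul, ENNReal.toReal_inv,
      ENNReal.toReal_add (ENNReal.add_ne_top.2 ⟨hfin _, hfin _⟩) (hfin _),
      ENNReal.toReal_add (hfin _) (hfin _)] at h'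
    simp only [ENNReal.toReal_ofNat, ENNReal.toReal_one] at h'
    have hpos : (1 : ℝ) - 6⁻¹ * ((massAbove c (c + n)).toReal +
        (massAbove c (c + (n + 1 : ℕ))).toReal + (massAbove c (c + (n + 2 : ℕ))).toReal) ≠ 0 := by
      have := hle (c + n); have := hle (c + (n + 1 : ℕ)); have := hle (c + (n + 2 : ℕ))
      apply ne_of_gt
      linarith
    have h2 := congrArg (fun x => x * ((1 : ℝ) - 6⁻¹ * ((massAbove c (c + n)).toReal +
        (massAbove c (c + (n + 1 : ℕ))).toReal + (massAbove c (c + (n + 2 : ℕ))).toReal))) h'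
    simp only [inv_mul_cancel_right₀ hpos] at h2
    linarith
  -- Squeeze between `n / (n+1)`, the mass of trees with fewer than `n` generations, and `1`.
  · refine tendsto_of_tendsto_of_tendsto_of_le_of_le (tendsto_natCast_div_add_atTop (1 : ℝ))
      tendsto_const_nhds (fun n => ?_) (fun n => hle _)
    have h := ENNReal.toReal_mono (hfin _) (div_le_massAbove c (c + n) n le_rfl)
    rw [ENNReal.toReal_div, ENNReal.toReal_add (by simp) (by simp)] at h
    simpa using h

end LabeledTree

theorem boltzmann_lt_minLabel (c k : ℤ) :
    (boltzmann k).toMeasure {t : WLTree k | c < t.1.minLabel} = LabeledTree.massAbove c k := by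
  rw [PMF.toMeasure_apply _ (MeasurableSet.of_discrete), LabeledTree.massAbove]
  have := tsum_subtype {t : LabeledTree | t.WellLabeled ∧ t.rootLabel = k}
    (fun t => if c < t.minLabel then (12⁻¹ : ℝ≥0∞) ^ t.numEdges / 2 else 0)
  refine Eq.trans (Eq.trans (tsum_congr fun t => ?_) this) (tsum_congr fun t => ?_)
  · simp only [Set.indicator, boltzmann, Set.mem_ofPred_eq]
    split_ifs <;> rfl
  · simp [Set.indicator, LabeledTree.weightAbove, LabeledTree.weight]
    grind

/-! ### Coin flips and conditioning on the first step -/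

namespace TreedBridge

/-- The law of a sequence of independent fair coin flips. -/
noncomputable abbrev coinFlips : Measure (ℕ → Bool) :=
  Measure.infinitePi fun _ : ℕ => (PMF.uniformOfFintype Bool).toMeasure

/-- The sequence `s` with the term `c` added in front. -/
def consSeq (p : Bool × (ℕ → Bool)) : ℕ → Bool
  | 0 => p.1
  | n + 1 => p.2 n

theorem measurable_consSeq : Measurable consSeq := by
  rw [measurable_pi_iff]
  rintro (_ | n)
  · exact measurable_fst
  · exact (measurable_pi_apply n).comp measurable_snd

/-- Prepending a fair coin preserves the product law, as is checked on finite-dimensional boxes.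
This is the Markov property at time one. -/
theorem map_consSeq :
    ((PMF.uniformOfFintype Bool).toMeasure.prod coinFlips).map consSeq = coinFlips := by
  refine Measure.eq_infinitePi _ fun S t ht => ?_
  rw [Measure.map_apply measurable_consSeq
    (MeasurableSet.pi (Finset.countable_toSet S) fun i _ => ht i)]
  have hS : S ⊆ Finset.range (S.sup id + 1) := fun i hi =>
    Finset.mem_range.2 (Nat.lt_succ_of_le (Finset.le_sup (f := id) hi))
  set N := S.sup id with hN
  clear_value N
  -- Padding with `univ` turns the box over `S` into one over an initial segment, which splits into
  -- its coordinate `0` and a shifted box.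
  let t' : ℕ → Set Bool := fun i => if i ∈ S then t i else Set.univ
  have hpre : consSeq ⁻¹' (S : Set ℕ).pi t
      = t' 0 ×ˢ (Finset.range N : Set ℕ).pi fun i => t' (i + 1) := by
    ext ⟨c, s⟩
    simp only [Set.mem_preimage, Set.mem_pi, Set.mem_prod, Finset.mem_coe, t', Finset.mem_range]
    constructor
    · intro h
      refine ⟨?_, fun i _ => ?_⟩
      · split_ifs with h0
        · exact h 0 h0
        · trivial
      · split_ifs with h0
        · exact h _ h0
        · trivial
    · rintro ⟨h0, h1⟩ (_ | i) hi
      · rwa [if_pos hi] at h0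
      · have hlt := Finset.mem_range.1 (hS hi)
        have := h1 i (by omega)
        rwa [if_pos hi] at this
  rw [hpre, Measure.prod_prod, Measure.infinitePi_pi _ (fun i _ => by
    simp only [t']; split_ifs
    · exact ht _
    · exact MeasurableSet.univ)]
  have h2 : ∏ i ∈ S, (PMF.uniformOfFintype Bool).toMeasure (t i)
      = ∏ i ∈ Finset.range (N + 1), (PMF.uniformOfFintype Bool).toMeasure (t' i) := by
    rw [← Finset.prod_subset hS]
    · exact Finset.prod_congr rfl fun i hi => by simp [t', hi]
    · intro i _ hi
      simp only [t', if_neg hi, measure_univ]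
  rw [h2, Finset.prod_range_succ', mul_comm]

theorem lintegral_coinFlips (f : (ℕ → Bool) → ℝ≥0∞) (hf : Measurable f) :
    ∫⁻ s, f s ∂coinFlips = 2⁻¹ * (∫⁻ s, f (consSeq (true, s)) ∂coinFlips
      + ∫⁻ s, f (consSeq (false, s)) ∂coinFlips) := by
  nth_rw 1 [← map_consSeq]
  rw [lintegral_map hf measurable_consSeq,
    lintegral_prod (fun p => f (consSeq p)) (hf.comp measurable_consSeq).aemeasurable, lintegral_fintype]
  simp only [Fintype.univ_bool, Finset.mem_singleton, Bool.true_eq_false, not_false_eq_true,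
    Finset.sum_insert, Finset.sum_singleton]
  rw [PMF.toMeasure_apply_singleton _ _ (measurableSet_singleton _),
    PMF.toMeasure_apply_singleton _ _ (measurableSet_singleton _)]
  simp [mul_add, mul_comm]

theorem walk_zero (s : ℕ → Bool) : walk s 0 = 0 := by simp [walk]

theorem walk_succ (s : ℕ → Bool) (n : ℕ) : walk s (n + 1) = walk s n + if s n then 1 else -1 := by
  simp [walk, Finset.sum_range_succ]

theorem walk_consSeq (c : Bool) (s : ℕ → Bool) (n : ℕ) :
    walk (consSeq (c, s)) (n + 1) = (if c then 1 else -1) + walk s n := by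
  simp only [walk, Finset.sum_range_succ', consSeq]
  exact add_comm _ _

theorem measurable_walk (n : ℕ) : Measurable fun s : ℕ → Bool => walk s n := by
  unfold walk
  refine Finset.measurable_sum _ fun k _ => ?_
  exact (measurable_of_countable fun c : Bool => if c then (1 : ℤ) else -1).comp
    (measurable_pi_apply k)

/-! ### Expected multiplicative weight of the walk stopped at `-1` -/

/-- The weight of the `i`-th step of the walk started from `k`: an up-step from height `x` has
weight `α x`, a down-step `β x`, and the steps after the hitting time of `-1` have weight one. -/
noncomputable def stepWeight (α β : ℤ → ℝ≥0∞) (k : ℤ) (s : ℕ → Bool) (i : ℕ) : ℝ≥0∞ :=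
  open Classical in if ∀ j ≤ i, k + walk s j ≠ -1 then
    if s i then α (k + walk s i) else β (k + walk s i) else 1

theorem measurable_stepWeight (α β : ℤ → ℝ≥0∞) (k : ℤ) (i : ℕ) :
    Measurable fun s => stepWeight α β k s i := by
  have hw : ∀ f : ℤ → ℝ≥0∞, Measurable fun s : ℕ → Bool => f (k + walk s i) := fun f =>
    (measurable_of_countable fun x : ℤ => f (k + x)).comp (measurable_walk i)
  unfold stepWeight
  refine Measurable.ite ?_ (Measurable.ite ?_ (hw α) (hw β)) measurable_const
  · simp only [Set.ofPred_forall]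
    refine MeasurableSet.iInter fun j => MeasurableSet.iInter fun _ => ?_
    exact (measurable_walk j) (MeasurableSet.of_discrete (s := {x : ℤ | k + x ≠ -1}))
  · exact measurableSet_eq_fun (measurable_pi_apply i) measurable_const

/-- The expected weight of the first `n` steps of the walk started from `k` and stopped
at `-1`. -/
noncomputable def expWeight (α β : ℤ → ℝ≥0∞) (n : ℕ) (k : ℤ) : ℝ≥0∞ :=
  ∫⁻ s, ∏ i ∈ Finset.range n, stepWeight α β k s i ∂coinFlips

theorem expWeight_zero (α β : ℤ → ℝ≥0∞) (k : ℤ) : expWeight α β 0 k = 1 := by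
  simp [expWeight]

theorem expWeight_neg_one (α β : ℤ → ℝ≥0∞) (n : ℕ) : expWeight α β n (-1) = 1 := by
  have h : ∀ s i, stepWeight α β (-1) s i = 1 := fun s i => by
    rw [stepWeight, if_neg]
    intro h
    exact h 0 (Nat.zero_le _) (by simp [walk_zero])
  simp [expWeight, h]

theorem stepWeight_consSeq_succ (α β : ℤ → ℝ≥0∞) {k : ℤ} (hk : k ≠ -1) (c : Bool) (s : ℕ → Bool)
    (i : ℕ) : stepWeight α β k (consSeq (c, s)) (i + 1)
      = stepWeight α β (k + if c then 1 else -1) s i := by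
  have h : (∀ j ≤ i + 1, k + walk (consSeq (c, s)) j ≠ -1) ↔
      ∀ j ≤ i, (k + if c then 1 else -1) + walk s j ≠ -1 := by
    constructor
    · intro h j hj
      have := h (j + 1) (by omega)
      rwa [walk_consSeq, ← add_assoc] at this
    · rintro h (_ | j) hj
      · simpa [walk_zero] using hk
      · rw [walk_consSeq, ← add_assoc]
        exact h j (by omega)
  unfold stepWeight
  rw [walk_consSeq, ← add_assoc]
  by_cases hc : ∀ j ≤ i, (k + if c then 1 else -1) + walk s j ≠ -1
  · rw [if_pos hc, if_pos (h.2 hc)]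
    rfl
  · rw [if_neg hc, if_neg (mt h.1 hc)]

/-- First-step analysis. Away from `-1` the first step has its full weight, and the remaining steps
see the same weights from the new height. -/
theorem expWeight_succ (α β : ℤ → ℝ≥0∞) {k : ℤ} (hk : k ≠ -1) (n : ℕ) :
    expWeight α β (n + 1) k
      = 2⁻¹ * (α k * expWeight α β n (k + 1) + β k * expWeight α β n (k - 1)) := by
  have hm : ∀ n k, Measurable fun s => ∏ i ∈ Finset.range n, stepWeight α β k s i := fun n k =>
    Finset.measurable_prod _ fun i _ => measurable_stepWeight α β k i
  have h0 : ∀ c s, stepWeight α β k (consSeq (c, s)) 0 = if c then α k else β k := by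
    intro c s
    rw [stepWeight, if_pos (by intro j hj; simpa [Nat.le_zero.1 hj, walk_zero] using hk)]
    simp [walk_zero, consSeq]
  unfold expWeight
  rw [lintegral_coinFlips _ (hm _ _)]
  simp only [Finset.prod_range_succ', stepWeight_consSeq_succ α β hk, h0, if_true,
    Bool.false_eq_true, if_false, ← sub_eq_add_neg]
  rw [lintegral_mul_const _ (hm _ _), lintegral_mul_const _ (hm _ _), mul_comm (α k),
    mul_comm (β k)]

theorem expWeight_le_one {α β : ℤ → ℝ≥0∞} (hα : ∀ k, α k ≤ 1) (hβ : ∀ k, β k ≤ 1) (n : ℕ) (k : ℤ) :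
    expWeight α β n k ≤ 1 := by
  calc expWeight α β n k ≤ ∫⁻ s, 1 ∂coinFlips := by
        refine lintegral_mono fun s => Finset.prod_le_one' fun i _ => ?_
        unfold stepWeight
        split_ifs <;> simp [hα, hβ]
    _ = 1 := by simp

/-- A bounded nonnegative convex sequence vanishing at `0` vanishes at `1`. -/
theorem eq_zero_of_convex_of_bounded (D : ℕ → ℝ) (h0 : D 0 = 0) (hD : ∀ n, 0 ≤ D n)
    (hle : ∀ n, D n ≤ 1) (hc : ∀ n, 2 * D (n + 1) ≤ D (n + 2) + D n) : D 1 = 0 := by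
  -- Convexity makes the increments nondecreasing, so `D` grows at least linearly with slope `D 1`;
  -- boundedness then excludes `D 1 > 0`.
  have hinc : ∀ n, D 1 ≤ D (n + 1) - D n := by
    intro n
    induction n with
    | zero => simp [h0]
    | succ n ih => have := hc n; linarith
  have hlin : ∀ n : ℕ, n * D 1 ≤ D n := by
    intro n
    induction n with
    | zero => simp [h0]
    | succ n ih => have := hinc n; push_cast; linarith
  by_contra hne
  have hpos : 0 < D 1 := lt_of_le_of_ne (hD 1) (Ne.symm hne)
  obtain ⟨n, hn⟩ := exists_nat_gt (1 / D 1)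
  rw [div_lt_iff₀ hpos] at hn
  linarith [hlin n, hle n]

/-- The expected weight of the walk started from `0` and stopped at `-1` is given by any bounded
solution `V` of the harmonic equation, where `V n` stands for the starting height `n - 1`. -/
theorem tendsto_expWeight {α β : ℤ → ℝ≥0∞} (hα : ∀ k, α k ≤ 1) (hβ : ∀ k, β k ≤ 1) (V : ℕ → ℝ)
    (hV0 : V 0 = 1) (hVnn : ∀ n, 0 ≤ V n) (hV1 : ∀ n, V n ≤ 1)
    (hV : ∀ n : ℕ, 2 * V (n + 1) = (α n).toReal * V (n + 2) + (β n).toReal * V n) :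
    Filter.Tendsto (fun n => (expWeight α β n 0).toReal) Filter.atTop (nhds (V 1)) := by
  set a : ℕ → ℝ := fun n => (α n).toReal with ha
  set b : ℕ → ℝ := fun n => (β n).toReal with hb
  have hr : ∀ x : ℝ≥0∞, x ≤ 1 → x.toReal ≤ 1 := fun x hx => by
    simpa using ENNReal.toReal_mono ENNReal.one_ne_top hx
  have ha0 : ∀ n, 0 ≤ a n := fun n => ENNReal.toReal_nonneg
  have hb0 : ∀ n, 0 ≤ b n := fun n => ENNReal.toReal_nonneg
  have ha1 : ∀ n, a n ≤ 1 := fun n => hr _ (hα _)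
  have hb1 : ∀ n, b n ≤ 1 := fun n => hr _ (hβ _)
  -- Heights are shifted by one, which puts the absorbing state `-1` at index `0`.
  let g : ℕ → ℕ → ℝ := fun n k => (expWeight α β n ((k : ℤ) - 1)).toReal
  have hle : ∀ n k, expWeight α β n k ≤ 1 := expWeight_le_one hα hβ
  have hg0 : ∀ k, g 0 k = 1 := fun k => by simp [g, expWeight_zero]
  have hgz : ∀ n, g n 0 = 1 := fun n => by simp [g, expWeight_neg_one]
  have hg : ∀ n k, g (n + 1) (k + 1) = 2⁻¹ * (a k * g n (k + 2) + b k * g n k) := by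
    intro n k
    have hfin : ∀ n k, expWeight α β n k ≠ ∞ := fun n k =>
      ne_top_of_le_ne_top ENNReal.one_ne_top (hle n k)
    have hfa := ne_top_of_le_ne_top ENNReal.one_ne_top (hα k)
    have hfb := ne_top_of_le_ne_top ENNReal.one_ne_top (hβ k)
    simp only [g]
    rw [show ((k + 1 : ℕ) : ℤ) - 1 = k by push_cast; ring, expWeight_succ _ _ (by omega),
      ENNReal.toReal_mul, ENNReal.toReal_add (ENNReal.mul_ne_top hfa (hfin _ _))
      (ENNReal.mul_ne_top hfb (hfin _ _)), ENNReal.toReal_mul, ENNReal.toReal_mul,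
      show ((k + 2 : ℕ) : ℤ) - 1 = k + 1 by push_cast; ring]
    simp [ha, hb]
  have hg1 : ∀ n k, g n k ≤ 1 := fun n k => hr _ (hle _ _)
  -- The iteration is monotone and starts from the constant `1 ≥ V`, so it stays above the fixed
  -- point `V`; `hanti` uses the same monotonicity to get convergence.
  have hVg : ∀ n k, V k ≤ g n k := by
    intro n
    induction n with
    | zero => intro k; rw [hg0]; exact hV1 k
    | succ n ih =>
      rintro (_ | k)
      · rw [hV0, hgz]
      · rw [hg]
        have := mul_le_mul_of_nonneg_left (ih (k + 2)) (ha0 k)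
        have := mul_le_mul_of_nonneg_left (ih k) (hb0 k)
        have := hV k
        linarith
  have hanti : ∀ n k, g (n + 1) k ≤ g n k := by
    intro n
    induction n with
    | zero => intro k; rw [hg0]; exact hg1 _ _
    | succ n ih =>
      rintro (_ | k)
      · rw [hgz, hgz]
      · rw [hg (n + 1) k, hg n k]
        have := mul_le_mul_of_nonneg_left (ih (k + 2)) (ha0 k)
        have := mul_le_mul_of_nonneg_left (ih k) (hb0 k)
        linarith
  have hlim : ∀ k, ∃ l, Filter.Tendsto (fun n => g n k) Filter.atTop (nhds l) := fun k =>
    ⟨_, tendsto_atTop_ciInf (antitone_nat_of_succ_le fun n => hanti n k)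
      ⟨V k, by rintro _ ⟨n, rfl⟩; exact hVg n k⟩⟩
  choose l hl using hlim
  have hlV : ∀ k, V k ≤ l k := fun k => ge_of_tendsto' (hl k) fun n => hVg n k
  have hl1 : ∀ k, l k ≤ 1 := fun k => le_of_tendsto' (hl k) fun n => hg1 n k
  have hl0 : l 0 = 1 := by
    have := hl 0
    simp only [hgz] at this
    exact tendsto_nhds_unique this tendsto_const_nhds
  have hlrec : ∀ k, l (k + 1) = 2⁻¹ * (a k * l (k + 2) + b k * l k) := by
    intro k
    have h1 := (Filter.tendsto_add_atTop_iff_nat 1).2 (hl (k + 1))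
    simp only [hg] at h1
    exact tendsto_nhds_unique h1
      ((((hl (k + 2)).const_mul (a k)).add ((hl k).const_mul (b k))).const_mul 2⁻¹)
  -- The difference `D = l - V` solves the linear equation. Since `D ≥ 0` and the weights are at
  -- most `1`, it follows that `2 D (k+1) ≤ D (k+2) + D k`.
  have hzero := eq_zero_of_convex_of_bounded (fun k => l k - V k) (by simp [hl0, hV0])
    (fun k => sub_nonneg.2 (hlV k)) (fun k => by linarith [hl1 k, hVnn k]) (fun k => by
      have h1 := mul_le_mul_of_nonneg_right (ha1 k) (sub_nonneg.2 (hlV (k + 2)))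
      have h2 := mul_le_mul_of_nonneg_right (hb1 k) (sub_nonneg.2 (hlV k))
      have h3 := hlrec k
      have h4 := hV k
      linarith)
  have h := hl 1
  rw [sub_eq_zero.1 hzero] at h
  simpa [g] using h

end TreedBridge

/-! ### Averaging over the trees for a fixed walk -/

namespace TreedBridge

open LabeledTree

/-- The law of a family of independent trees, the tree at `(i, k)` having law `ρ_k`. -/
noncomputable abbrev treeField : Measure (∀ p : ℤ × ℤ, WLTree p.2) :=
  Measure.infinitePi fun p : ℤ × ℤ => (boltzmann p.2).toMeasure

/-- Before its hitting time of `-1`, the walk makes among its first `n` steps no step in the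
direction `d` whose tree has a label `≤ c`. The tree of the `i`-th step lies at the site `ι i`, and
its root label is the height of the walk plus `e`. -/
def allAbove (c : ℤ) (d : Bool) (e : ℤ) (ι : ℕ → ℤ) (n : ℕ) :
    Set ((ℕ → Bool) × (∀ p : ℤ × ℤ, WLTree p.2)) :=
  {p | ∀ i < n, p.1 i = d → (∀ j ≤ i, walk p.1 j ≠ -1) →
    c < (p.2 (ι i, walk p.1 i + e)).1.minLabel}

theorem measurableSet_allAbove (c : ℤ) (d : Bool) (e : ℤ) (ι : ℕ → ℤ) (n : ℕ) :
    MeasurableSet (allAbove c d e ι n) := by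
  have hw : ∀ i, Measurable fun p : (ℕ → Bool) × (∀ p : ℤ × ℤ, WLTree p.2) => walk p.1 i :=
    fun i => (measurable_walk i).comp measurable_fst
  have h1 : ∀ i, MeasurableSet {p : (ℕ → Bool) × (∀ p : ℤ × ℤ, WLTree p.2) | p.1 i = d} :=
    fun i => measurableSet_eq_fun ((measurable_pi_apply i).comp measurable_fst) measurable_const
  have h2 : ∀ i, MeasurableSet
      {p : (ℕ → Bool) × (∀ p : ℤ × ℤ, WLTree p.2) | ∀ j ≤ i, walk p.1 j ≠ -1} := by
    intro i
    simp only [Set.ofPred_forall]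
    exact MeasurableSet.iInter fun j => MeasurableSet.iInter fun _ =>
      (measurableSet_eq_fun (hw j) measurable_const).compl
  have h3 : ∀ i, MeasurableSet {p : (ℕ → Bool) × (∀ p : ℤ × ℤ, WLTree p.2) |
      c < (p.2 (ι i, walk p.1 i + e)).1.minLabel} := by
    intro i
    have : {p : (ℕ → Bool) × (∀ p : ℤ × ℤ, WLTree p.2) |
        c < (p.2 (ι i, walk p.1 i + e)).1.minLabel} = ⋃ k : ℤ, ({p | walk p.1 i = k} ∩
        (fun p => p.2 (ι i, k + e)) ⁻¹' {t : WLTree (k + e) | c < t.1.minLabel}) := by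
      ext p
      simp
    rw [this]
    exact MeasurableSet.iUnion fun k => (measurableSet_eq_fun (hw i) measurable_const).inter
      (((measurable_pi_apply (ι i, k + e)).comp measurable_snd) MeasurableSet.of_discrete)
  simp only [allAbove, Set.ofPred_forall]
  refine MeasurableSet.iInter fun i => MeasurableSet.iInter fun _ => ?_
  convert (((h1 i).compl.union (h2 i).compl).union (h3 i)) using 1
  ext p
  simp only [Set.mem_union, Set.mem_compl_iff, Set.mem_ofPred_eq]
  tauto

/-- The probability that the tree with root label `k` has all its labels above `c`, for the steps
in the direction `d`, and `1` for the other steps. -/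
noncomputable def dirWeight (c : ℤ) (d : Bool) (e : ℤ) (d' : Bool) (k : ℤ) : ℝ≥0∞ :=
  if d' = d then massAbove c (k + e) else 1

theorem dirWeight_le_one (c : ℤ) (d : Bool) (e : ℤ) (d' : Bool) (k : ℤ) :
    dirWeight c d e d' k ≤ 1 := by
  unfold dirWeight
  split_ifs <;> simp [massAbove_le_one]

/-- For a fixed walk, distinct steps use distinct sites because `ι` is injective, so independence of
the trees yields a product. -/
theorem treeField_allAbove (c : ℤ) (d : Bool) (e : ℤ) {ι : ℕ → ℤ} (hι : Function.Injective ι)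
    (n : ℕ) (s : ℕ → Bool) : treeField (Prod.mk s ⁻¹' allAbove c d e ι n)
      = ∏ i ∈ Finset.range n, stepWeight (dirWeight c d e true) (dirWeight c d e false) 0 s i := by
  classical
  let J := (Finset.range n).filter fun i => s i = d ∧ ∀ j ≤ i, walk s j ≠ -1
  have hset : Prod.mk s ⁻¹' allAbove c d e ι n
      = ((J.image fun i => (ι i, walk s i + e) : Finset (ℤ × ℤ)) : Set (ℤ × ℤ)).pi
        fun p => {t : WLTree p.2 | c < t.1.minLabel} := by
    ext θ
    simp only [allAbove, Set.mem_preimage, Set.mem_ofPred_eq, Set.mem_pi, Finset.mem_coe,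
      Finset.mem_image, J, Finset.mem_filter, Finset.mem_range]
    constructor
    · rintro h _ ⟨i, ⟨hi, hd, hw⟩, rfl⟩
      exact h i hi hd hw
    · intro h i hi hd hw
      exact h _ ⟨i, ⟨hi, hd, hw⟩, rfl⟩
  rw [hset, Measure.infinitePi_pi _ (fun _ _ => MeasurableSet.of_discrete),
    Finset.prod_image (fun i _ j _ hij => hι (Prod.ext_iff.1 hij).1), Finset.prod_filter]
  refine Finset.prod_congr rfl fun i _ => ?_
  rw [boltzmann_lt_minLabel]
  simp only [stepWeight, zero_add, dirWeight]
  by_cases h : ∀ j ≤ i, walk s j ≠ -1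
  · rw [if_pos h]
    rw [if_congr (and_iff_left h) rfl rfl]
    cases hs : s i <;> cases d <;> simp
  · rw [if_neg h, if_neg (fun h' => h h'.2)]

theorem prod_allAbove (c : ℤ) (d : Bool) (e : ℤ) {ι : ℕ → ℤ} (hι : Function.Injective ι)
    (n : ℕ) : (coinFlips.prod treeField) (allAbove c d e ι n)
      = expWeight (dirWeight c d e true) (dirWeight c d e false) n 0 := by
  rw [Measure.prod_apply (measurableSet_allAbove c d e ι n)]
  simp only [treeField_allAbove c d e hι]
  rfl

/-- Continuity from above along the decreasing events, combined with the limit of `expWeight`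
identified by the harmonic function `V`. -/
theorem prod_iInter_allAbove (c : ℤ) (d : Bool) (e : ℤ) {ι : ℕ → ℤ} (hι : Function.Injective ι)
    (V : ℕ → ℝ) (hV0 : V 0 = 1) (hVnn : ∀ n, 0 ≤ V n) (hV1 : ∀ n, V n ≤ 1)
    (hV : ∀ n : ℕ, 2 * V (n + 1) = (dirWeight c d e true n).toReal * V (n + 2)
      + (dirWeight c d e false n).toReal * V n) :
    (coinFlips.prod treeField) (⋂ n, allAbove c d e ι n) = ENNReal.ofReal (V 1) := by
  have h1 := tendsto_measure_iInter_atTop (μ := coinFlips.prod treeField)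
    (fun n => (measurableSet_allAbove c d e ι n).nullMeasurableSet)
    (fun n n' hn p hp i hi => hp i (lt_of_lt_of_le hi hn)) ⟨0, measure_ne_top _ _⟩
  simp only [Function.comp_def, prod_allAbove c d e hι] at h1
  have h2 := tendsto_expWeight (dirWeight_le_one c d e true) (dirWeight_le_one c d e false)
    V hV0 hVnn hV1 hV
  have h3 := (ENNReal.tendsto_toReal (measure_ne_top (coinFlips.prod treeField)
    (⋂ n, allAbove c d e ι n))).comp h1
  rw [tendsto_nhds_unique h2 h3, ENNReal.ofReal_toReal (measure_ne_top _ _)]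

/-! ### The events `Δ_0 ≥ m` and `Δ'_0 ≥ m` in terms of walks -/

/-- Some down-step `ι i` such that the bridge avoids `-1` at the times `κ 0, …, κ i` carries a tree
with a label `≤ c`. -/
def someBelow (c : ℤ) (ι κ : ℕ → ℤ) : Set TreedBridge :=
  {x | ∃ (i : ℕ) (hi : ι i ∈ DS x.b), (∀ j ≤ i, x.b (κ j) ≠ -1) ∧ (x.T (ι i) hi).1.minLabel ≤ c}

theorem measurableSet_someBelow (c : ℤ) (ι κ : ℕ → ℤ) : MeasurableSet (someBelow c ι κ) := by
  have h : someBelow c ι κ = ⋃ i : ℕ, ((⋂ (j : ℕ) (_ : j ≤ i), {x | x.b (κ j) = -1}ᶜ) ∩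
      {x | ∃ hi : ι i ∈ DS x.b, (x.T (ι i) hi).1 ∈ {t : LabeledTree | t.minLabel ≤ c}}) := by
    ext x
    simp only [someBelow, Set.mem_ofPred_eq, Set.mem_iUnion, Set.mem_inter_iff, Set.mem_iInter,
      Set.mem_compl_iff]
    grind
  rw [h]
  refine MeasurableSet.iUnion fun i => MeasurableSet.inter (MeasurableSet.iInter fun j =>
    MeasurableSet.iInter fun _ => MeasurableSet.compl ?_) ?_
  · exact MeasurableSpace.measurableSet_generateFrom (Or.inl ⟨_, _, rfl⟩)
  · exact MeasurableSpace.measurableSet_generateFrom (Or.inr ⟨_, _, rfl⟩)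

theorem lt_hitRight_iff (b : ℤ → ℤ) (j : ℕ) (i : ℤ) :
    ((i : ℝ) : EReal) < hitRight b j ↔ ∀ k, 0 ≤ k → b k = -(j : ℤ) → i < k := by
  constructor
  · intro h k hk hb
    have h1 := lt_of_lt_of_le h (iInf₂_le (f := fun (m : ℤ) (_ : m ∈ {m : ℤ | 0 ≤ m ∧
      b m = -(j : ℤ)}) => ((m : ℝ) : EReal)) k ⟨hk, hb⟩)
    exact_mod_cast h1
  · intro h
    refine lt_of_lt_of_le (b := (((i + 1 : ℤ) : ℝ) : EReal)) ?_ (le_iInf₂ fun k hk => ?_)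
    · exact_mod_cast Int.lt_succ i
    · exact_mod_cast h k hk.1 hk.2

theorem hitLeft_le_iff (b : ℤ → ℤ) (j : ℕ) (i : ℤ) :
    hitLeft b j ≤ ((i : ℝ) : EReal) ↔ ∀ k ≤ 0, b k = -(j : ℤ) → k ≤ i := by
  unfold hitLeft
  rw [iSup₂_le_iff]
  constructor
  · intro h k hk hb
    exact_mod_cast h k ⟨hk, hb⟩
  · intro h k hk
    exact_mod_cast h k hk.1 hk.2

theorem hitRight_zero (x : TreedBridge) : hitRight x.b 0 = 0 := by
  apply le_antisymm
  · calc hitRight x.b 0 ≤ (((0 : ℤ) : ℝ) : EReal) :=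
        iInf₂_le (f := fun (m : ℤ) (_ : m ∈ {m : ℤ | 0 ≤ m ∧
          x.b m = -((0 : ℕ) : ℤ)}) => ((m : ℝ) : EReal)) 0 ⟨le_rfl, by simp [x.b_zero]⟩
      _ = 0 := by simp
  · refine le_iInf₂ fun k hk => ?_
    exact_mod_cast hk.1

theorem hitLeft_zero (x : TreedBridge) : hitLeft x.b 0 = 0 := by
  apply le_antisymm
  · refine iSup₂_le fun k hk => ?_
    exact_mod_cast hk.1
  · calc (0 : EReal) = (((0 : ℤ) : ℝ) : EReal) := by simp
      _ ≤ hitLeft x.b 0 :=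
        le_iSup₂ (f := fun (m : ℤ) (_ : m ∈ {m : ℤ | m ≤ 0 ∧
          x.b m = -((0 : ℕ) : ℤ)}) => ((m : ℝ) : EReal)) 0 ⟨le_rfl, by simp [x.b_zero]⟩

/-- All the terms of the supremum are integers, so even over infinitely many trees it reaches `m`
only if some term does; otherwise it is at most `m - 1`. -/
theorem le_Delta_zero_iff (m : ℕ) (x : TreedBridge) :
    (m : EReal) ≤ Delta 0 x ↔ x ∈ someBelow (-m) (fun i => i) (fun j => j) := by
  constructor
  · intro h
    by_contra hx
    have hle : Delta 0 x ≤ (((m - 1 : ℤ) : ℝ) : EReal) := by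
      refine iSup_le fun i => iSup_le fun hi => iSup_le fun h0 => iSup_le fun h1 => ?_
      rw [hitRight_zero] at h0
      rw [lt_hitRight_iff] at h1
      have hi0 : 0 ≤ i := by exact_mod_cast h0
      lift i to ℕ using hi0
      have hlt : ¬ (x.T i hi).1.minLabel ≤ -m := fun hle => hx ⟨i, hi, fun j hj hb => by
        have := h1 j (by omega) (by simpa using hb)
        omega, hle⟩
      have : -((x.T i hi).1.minLabel + ((0 : ℕ) : ℤ)) ≤ (m - 1 : ℤ) := by push_cast; omega
      exact_mod_cast this
    have h2 := h.trans hle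
    have h3 : ((m : ℤ) : ℝ) ≤ ((m - 1 : ℤ) : ℝ) := by exact_mod_cast h2
    have h4 : (m : ℤ) ≤ m - 1 := by exact_mod_cast h3
    omega
  · rintro ⟨i, hi, hb, hle⟩
    change (x.T (i : ℤ) hi).1.minLabel ≤ _ at hle
    refine le_trans ?_ (le_iSup_of_le (i : ℤ) (le_iSup_of_le hi (le_iSup_of_le ?_
      (le_iSup_of_le ?_ le_rfl))))
    · have : (m : ℤ) ≤ -((x.T i hi).1.minLabel + ((0 : ℕ) : ℤ)) := by push_cast; omega
      exact_mod_cast this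
    · rw [hitRight_zero]
      exact_mod_cast Nat.zero_le i
    · rw [lt_hitRight_iff]
      intro k hk hbk
      lift k to ℕ using hk
      by_contra hki
      exact hb k (by omega) (by simpa using hbk)

/-- The site `-(i+1)` is the left endpoint of the `i`-th step read leftwards. Being at or right of
the hitting time `H'_1` means that `-1` is avoided at `0, …, -i`. The endpoint `-(i+1)` itself is
left unconstrained. -/
theorem le_Delta'_zero_iff (m : ℕ) (x : TreedBridge) :
    (m : EReal) ≤ Delta' 0 x ↔ x ∈ someBelow (-m) (fun i => -((i : ℤ) + 1)) (fun j => -j) := by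
  constructor
  · intro h
    by_contra hx
    have hle : Delta' 0 x ≤ (((m - 1 : ℤ) : ℝ) : EReal) := by
      refine iSup_le fun i => iSup_le fun hi => iSup_le fun h0 => iSup_le fun h1 => ?_
      rw [hitLeft_zero] at h1
      rw [hitLeft_le_iff] at h0
      have hi0 : i < 0 := by exact_mod_cast h1
      obtain ⟨n, rfl⟩ : ∃ n : ℕ, i = -((n : ℤ) + 1) := ⟨(-i - 1).toNat, by omega⟩
      have hlt : ¬ (x.T _ hi).1.minLabel ≤ -m := fun hle => hx ⟨n, hi, fun j hj hb => by
        have := h0 (-j) (by omega) (by simpa using hb)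
        omega, hle⟩
      have : -((x.T _ hi).1.minLabel + ((0 : ℕ) : ℤ)) ≤ (m - 1 : ℤ) := by push_cast; omega
      exact_mod_cast this
    have h2 := h.trans hle
    have h3 : ((m : ℤ) : ℝ) ≤ ((m - 1 : ℤ) : ℝ) := by exact_mod_cast h2
    have h4 : (m : ℤ) ≤ m - 1 := by exact_mod_cast h3
    omega
  · rintro ⟨i, hi, hb, hle⟩
    change (x.T (-((i : ℤ) + 1)) hi).1.minLabel ≤ _ at hle
    refine le_trans ?_ (le_iSup_of_le (-((i : ℤ) + 1)) (le_iSup_of_le hi (le_iSup_of_le ?_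
      (le_iSup_of_le ?_ le_rfl))))
    · have : (m : ℤ) ≤ -((x.T _ hi).1.minLabel + ((0 : ℕ) : ℤ)) := by push_cast; omega
      exact_mod_cast this
    · rw [hitLeft_le_iff]
      intro k hk hbk
      obtain ⟨n, rfl⟩ : ∃ n : ℕ, k = -(n : ℤ) := ⟨(-k).toNat, by omega⟩
      by_contra hki
      exact hb n (by omega) (by simpa using hbk)
    · rw [hitLeft_zero]
      have : -((i : ℤ) + 1) < 0 := by omega
      exact_mod_cast this

theorem twoSided_natCast (s s' : ℕ → Bool) (n : ℕ) : twoSided s s' n = walk s n := by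
  simp [twoSided]

theorem twoSided_neg_natCast (s s' : ℕ → Bool) (n : ℕ) : twoSided s s' (-n) = walk s' n := by
  rcases n with _ | n
  · simp [twoSided, walk]
  · rw [twoSided, if_neg (by push_cast; omega), neg_neg, Int.toNat_natCast]

theorem ofSource_mem_someBelow_right (c : ℤ) (ω : Source) :
    ofSource ω ∈ someBelow c (fun i => i) (fun j => j) ↔
      (ω.1, ω.2.2) ∉ ⋂ n, allAbove c false 0 (fun i => i) n := by
  have hDS : ∀ i : ℕ, (i : ℤ) ∈ DS (ofSource ω).b ↔ ω.1 i = false := by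
    intro i
    change twoSided ω.1 ω.2.1 (((i : ℤ)) + 1) = twoSided ω.1 ω.2.1 i - 1 ↔ _
    rw [← Nat.cast_succ, twoSided_natCast, twoSided_natCast, walk_succ]
    cases ω.1 i <;> simp <;> omega
  have hb : ∀ j : ℕ, (ofSource ω).b j = walk ω.1 j := fun j => twoSided_natCast ω.1 ω.2.1 j
  have hT : ∀ (i : ℕ) hi, ((ofSource ω).T i hi).1 = (ω.2.2 ((i : ℤ), walk ω.1 i + 0)).1 := by
    intro i hi
    change (ω.2.2 ((i : ℤ), twoSided ω.1 ω.2.1 i)).1 = _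
    rw [twoSided_natCast, add_zero]
  simp only [someBelow, Set.mem_ofPred_eq, hT, hb, hDS, allAbove, Set.mem_iInter, exists_prop]
  push Not
  constructor
  · rintro ⟨i, h1, h2, h3⟩
    exact ⟨i + 1, i, Nat.lt_succ_self i, h1, h2, h3⟩
  · rintro ⟨n, i, -, h1, h2, h3⟩
    exact ⟨i, h1, h2, h3⟩

/-- Reading the left half away from `0` reverses steps: a down-step of the bridge is an up-step of
the left walk, and its root label is the height after that step. Hence the direction `true` and the
offset `1`. -/
theorem ofSource_mem_someBelow_left (c : ℤ) (ω : Source) :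
    ofSource ω ∈ someBelow c (fun i => -((i : ℤ) + 1)) (fun j => -j) ↔
      ω.2 ∉ ⋂ n, allAbove c true 1 (fun i => -((i : ℤ) + 1)) n := by
  have hDS : ∀ i : ℕ, -((i : ℤ) + 1) ∈ DS (ofSource ω).b ↔ ω.2.1 i = true := by
    intro i
    change twoSided ω.1 ω.2.1 (-((i : ℤ) + 1) + 1) = twoSided ω.1 ω.2.1 (-((i : ℤ) + 1)) - 1 ↔ _
    rw [show -((i : ℤ) + 1) + 1 = -(i : ℤ) by ring, ← Nat.cast_succ, twoSided_neg_natCast,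
      twoSided_neg_natCast, walk_succ]
    cases ω.2.1 i <;> simp
    omega
  have hb : ∀ j : ℕ, (ofSource ω).b (-j) = walk ω.2.1 j := fun j => twoSided_neg_natCast ω.1 ω.2.1 j
  have hT : ∀ (i : ℕ) hi, ((ofSource ω).T (-((i : ℤ) + 1)) hi).1
      = (ω.2.2 (-((i : ℤ) + 1), walk ω.2.1 i + 1)).1 := by
    intro i hi
    change (ω.2.2 (-((i : ℤ) + 1), twoSided ω.1 ω.2.1 (-((i : ℤ) + 1)))).1 = _
    have h : twoSided ω.1 ω.2.1 (-((i : ℤ) + 1)) = walk ω.2.1 i + 1 := by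
      rw [← Nat.cast_succ, twoSided_neg_natCast, walk_succ, if_pos ((hDS i).1 hi)]
    rw [h]
  simp only [someBelow, Set.mem_ofPred_eq, hT, hb, hDS, allAbove, Set.mem_iInter, exists_prop]
  push Not
  constructor
  · rintro ⟨i, h1, h2, h3⟩
    exact ⟨i + 1, i, Nat.lt_succ_self i, h1, h2, h3⟩
  · rintro ⟨n, i, -, h1, h2, h3⟩
    exact ⟨i, h1, h2, h3⟩

theorem measurePreserving_right : MeasurePreserving (fun ω : Source => (ω.1, ω.2.2))
    sourceMeasure (coinFlips.prod treeField) :=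
  (MeasurePreserving.id _).prod measurePreserving_snd

theorem measurePreserving_left : MeasurePreserving (fun ω : Source => ω.2)
    sourceMeasure (coinFlips.prod treeField) :=
  measurePreserving_snd

/-! ### Explicit harmonic functions -/

theorem toReal_dirWeight_self (m : ℕ) (d : Bool) (e n : ℕ) :
    (dirWeight (-m) d e d n).toReal
      = (n + e + m) * (n + e + m + 3) / ((n + e + m + 1) * (n + e + m + 2)) := by
  have := toReal_massAbove (-m) (n + e + m)
  rw [show (-m : ℤ) + (n + e + m : ℕ) = n + e by push_cast; ring] at this
  rw [dirWeight, if_pos rfl, this]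
  push_cast
  rfl

/-- With `N = n + m`, the factor `N` of the tree mass cancels the denominator of `V n = m/N`, and
the equation reduces to `(N+1) + (N+3) = 2 (N+2)`. -/
theorem prod_right (m : ℕ) (hm : 1 ≤ m) :
    (coinFlips.prod treeField) (⋂ n, allAbove (-m) false 0 (fun i => i) n)
      = ENNReal.ofReal (m / (m + 1)) := by
  have hm' : (1 : ℝ) ≤ m := by exact_mod_cast hm
  rw [prod_iInter_allAbove (-m) false 0 Nat.cast_injective (fun n => m / (m + n))]
  · simp
  -- The boundary value needs `m ≠ 0`, since `0 / 0 = 0`.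
  · simp; omega
  · intro n; positivity
  · intro n
    rw [div_le_one (by positivity)]
    linarith [(n.cast_nonneg : (0 : ℝ) ≤ n)]
  · intro n
    have h := toReal_dirWeight_self m false 0 n
    push_cast at h
    rw [h, dirWeight, if_neg (by simp)]
    push_cast
    simp only [ENNReal.toReal_one, add_zero]
    field_simp
    ring

/-- The tree mass now multiplies `V (n+2)`. With `M = n + m + 1` it is `M (M+3) / ((M+1)(M+2))`, and
its factor `M+3` cancels the denominator of `V (n+2)`; this dictates the shift `m + 2`. -/
theorem prod_left (m : ℕ) :
    (coinFlips.prod treeField) (⋂ n, allAbove (-m) true 1 (fun i => -((i : ℤ) + 1)) n)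
      = ENNReal.ofReal ((m + 2) / (m + 3)) := by
  have hm' : (0 : ℝ) ≤ m := m.cast_nonneg
  rw [prod_iInter_allAbove (-m) true 1 (fun i j h => by simpa using h)
    (fun n => (m + 2) / (m + 2 + n))]
  · congr 2
    push_cast
    ring
  · simp only [Nat.cast_zero, add_zero]
    exact div_self (by positivity)
  · intro n; positivity
  · intro n
    rw [div_le_one (by positivity)]
    linarith [(n.cast_nonneg : (0 : ℝ) ≤ n)]
  · intro n
    have h := toReal_dirWeight_self m true 1 n
    push_cast at h
    rw [h, dirWeight, if_neg (by simp)]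
    push_cast
    simp only [ENNReal.toReal_one]
    field_simp
    ring

end TreedBridge

/-! ### Transfer to the law of the bridge -/

theorem proposition2 {Ω : Type*} [MeasurableSpace Ω] (P : Measure Ω) (X : Ω → TreedBridge)
    (hX : HasLaw X uniformInfiniteTreedBridge P) (m : ℕ) (hm : 1 ≤ m) :
    P {ω | (m : EReal) ≤ TreedBridge.Delta 0 (X ω)} = 1 / ((m : ℝ≥0∞) + 1) ∧
      P {ω | (m : EReal) ≤ TreedBridge.Delta' 0 (X ω)} = 1 / ((m : ℝ≥0∞) + 3) := by
  open TreedBridge in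
  have hA : ∀ c d e ι, MeasurableSet (⋂ n, allAbove c d e ι n) := fun c d e ι =>
    MeasurableSet.iInter fun n => measurableSet_allAbove c d e ι n
  have hinv : ∀ k : ℕ, 0 < k → 1 / ((m : ℝ≥0∞) + k) = ENNReal.ofReal (1 / (m + k)) := by
    intro k hk
    rw [ENNReal.ofReal_div_of_pos (by positivity), ENNReal.ofReal_add (by positivity) (by simp)]
    simp
  constructor
  · simp only [le_Delta_zero_iff]
    rw [hX.measure_eq (p := fun x => x ∈ someBelow (-m) (fun i => i) (fun j => j))
      (measurableSet_someBelow _ _ _)]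
    -- Back on the source space, the event involves only one of the two walks and the tree field, so
    -- the other walk is integrated out and the complement is computed.
    change (sourceMeasure.map ofSource) (someBelow _ _ _) = _
    rw [Measure.map_apply measurable_ofSource (measurableSet_someBelow _ _ _)]
    have hpre : ofSource ⁻¹' someBelow (-m) (fun i => i) (fun j => j)
        = (fun ω : Source => (ω.1, ω.2.2)) ⁻¹'
          (⋂ n, allAbove (-m) false 0 (fun i => i) n)ᶜ := by
      ext ω
      exact ofSource_mem_someBelow_right _ ω
    rw [hpre, measurePreserving_right.measure_preimage (hA _ _ _ _).compl.nullMeasurableSet,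
      prob_compl_eq_one_sub (hA _ _ _ _), prod_right m hm, ← ENNReal.ofReal_one,
      ← ENNReal.ofReal_sub _ (by positivity), ENNReal.ofReal_one]
    have := hinv 1 one_pos
    rw [Nat.cast_one, Nat.cast_one] at this
    rw [this]
    congr 1
    field_simp
    ring
  · simp only [le_Delta'_zero_iff]
    rw [hX.measure_eq (p := fun x => x ∈ someBelow (-m) (fun i => -((i : ℤ) + 1)) (fun j => -j))
      (measurableSet_someBelow _ _ _)]
    change (sourceMeasure.map ofSource) (someBelow _ _ _) = _
    rw [Measure.map_apply measurable_ofSource (measurableSet_someBelow _ _ _)]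
    have hpre : ofSource ⁻¹' someBelow (-m) (fun i => -((i : ℤ) + 1)) (fun j => -j)
        = (fun ω : Source => ω.2) ⁻¹'
          (⋂ n, allAbove (-m) true 1 (fun i => -((i : ℤ) + 1)) n)ᶜ := by
      ext ω
      exact ofSource_mem_someBelow_left _ ω
    rw [hpre, measurePreserving_left.measure_preimage (hA _ _ _ _).compl.nullMeasurableSet,
      prob_compl_eq_one_sub (hA _ _ _ _), prod_left m, ← ENNReal.ofReal_one,
      ← ENNReal.ofReal_sub _ (by positivity), ENNReal.ofReal_one]
    have := hinv 3 (by norm_num)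
    push_cast at this
    rw [this]
    congr 1
    field_simp
    ring
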